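/- Let $d$ be a natural number, let $G=(V,E)$ be a finite simple graph and let $u,v\in V$. A realization of a graph $H$ in $\mathbb{R}^d$ is a map $p:V(H)\to\mathbb{R}^d$; it is generic if its $d|V(H)|$ coordinates are algebraically independent over $\mathbb{Q}$. Realizations $p,q$ of $H$ are equivalent if $\|p(x)-p(y)\|=\|q(x)-q(y)\|$ (Euclidean norm) for every edge $xy$ of $H$, and congruent if this holds for all $x,y\in V(H)$. A realization $p$ of $H$ is rigid if there is $\varepsilon>0$ such that every realization $q$ of $H$ that is equivalent to $p$ and satisfies $\|p(x)-q(x)\|<\varepsilon$ for all $x\in V(H)$ is congruent to $p$; the graph $H$ is rigid in $\mathbb{R}^d$ if every generic realization of $H$ in $\mathbb{R}^d$ is rigid. Suppose that there is some $V_0\subseteq V$ such that $u,v\in V_0$, the induced subgraph $G[V_0]$ is rigid in $\mathbb{R}^d$, and there is a path in $G$ from $u$ to $v$ none of whose internal vertices belongs to $V_0$. Then $\{u,v\}$ is weakly globally linked in $G$ in $\mathbb{R}^d$: there exists a generic realization $p$ of $G$ in $\mathbb{R}^d$ such that $\|p(u)-p(v)\|=\|q(u)-q(v)\|$ for every realization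 $q$ of $G$ in $\mathbb{R}^d$ that is equivalent to $p$. -/

import Mathlib

namespace GraphRigidity

/-- A realization of a graph with vertex set `V` in `ℝ^d` (with the Euclidean norm). -/
abbrev Realization (V : Type*) (d : ℕ) := V → EuclideanSpace ℝ (Fin d)

/-- The frameworks `(G, p)` and `(G, q)` have the same edge lengths. -/
def Equivalent {V : Type*} {d : ℕ} (G : SimpleGraph V) (p q : Realization V d) : Prop :=
  ∀ x y : V, G.Adj x y → ‖p x - p y‖ = ‖q x - q y‖

/-- All pairwise distances agree in `p` and `q`. -/
def Congruent {V : Type*} {d : ℕ} (p q : Realization V d) : Prop :=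
  ∀ x y : V, ‖p x - p y‖ = ‖q x - q y‖

/-- The (indexed family of) `d|V|` vertex coordinates is algebraically independent over `ℚ`. -/
def IsGeneric {V : Type*} {d : ℕ} (p : Realization V d) : Prop :=
  AlgebraicIndependent ℚ (fun c : V × Fin d => p c.1 c.2)

/-- The framework `(G, p)` is rigid in `ℝ^d`. -/
def IsRigidFramework {V : Type*} {d : ℕ} (G : SimpleGraph V) (p : Realization V d) : Prop :=
  ∃ ε : ℝ, 0 < ε ∧ ∀ q : Realization V d,
    Equivalent G p q → (∀ x : V, ‖p x - q x‖ < ε) → Congruent p q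

/-- The graph `G` is rigid in `ℝ^d`: every generic realization of it is rigid. -/
def IsRigid {V : Type*} (d : ℕ) (G : SimpleGraph V) : Prop :=
  ∀ p : Realization V d, IsGeneric p → IsRigidFramework G p

/-- The induced subgraph `G[X]` is `(u,v)`-rigid in `ℝ^d`. -/
def IsPairRigid {V : Type*} (d : ℕ) (G : SimpleGraph V) (u v : V) (X : Set V) : Prop :=
  u ∈ X ∧ v ∈ X ∧ IsRigid d (G.induce X)

/-- The pair `{u,v}` is globally linked in the framework `(G, p)`. -/
def GloballyLinkedIn {V : Type*} {d : ℕ} (G : SimpleGraph V) (p : Realization V d)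
    (u v : V) : Prop :=
  ∀ q : Realization V d, Equivalent G p q → ‖p u - p v‖ = ‖q u - q v‖

/-- The pair `{u,v}` is weakly globally linked in `G` in `ℝ^d`. -/
def WeaklyGloballyLinked {V : Type*} (d : ℕ) (G : SimpleGraph V) (u v : V) : Prop :=
  ∃ p : Realization V d, IsGeneric p ∧ GloballyLinkedIn G p u v

/-- The walk `P` from `u` to `v` is a path, none of whose internal vertices lies in `X`. -/
def IsInternallyDisjointPath {V : Type*} {G : SimpleGraph V} {u v : V} (P : G.Walk u v)
    (X : Set V) : Prop :=
  P.IsPath ∧ ∀ w ∈ P.support, w ≠ u → w ≠ v → w ∉ X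

end GraphRigidity


/-! If `{u, v}` is locally linked in a generic realization `p` of `G[V₀]`, then the squared distance
of `u` and `v` at `p` is algebraic over the squared edge lengths: otherwise the squared edge lengths
in a transcendence basis and this distance together would define a map that is open at `p`, and
the distance could be varied with all edge lengths fixed. By genericity, the resulting separable
polynomial relation `P` holds at all realizations, so the distance takes only finitely many values
on the realizations equivalent to `p`. Let `q₀` be one of them with the least distance. The square
of this least distance is a simple root of `P`, and the minimum over equivalent realizations is
lower semicontinuous. Hence, in realizations of `G[V₀]` near `q₀`, all equivalent realizations
whose distance does not exceed a bound slightly above the minimum have the same distance.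

To impose that bound in `G`, extend `q₀` by placing all vertices outside `V₀` at `q₀ u`. Then the
path has length exactly `‖q₀ u - q₀ v‖`. For a generic `p` near this extension the path is still
shorter than the bound, and its length is the same in all equivalent realizations.
-/

namespace GraphRigidity

open Filter Topology Polynomial

open scoped TensorProduct in
theorem exists_derivation_extending {K S L M : Type*} [CommRing K] [CommRing S] [CommRing L]
    [Algebra K S] [Algebra K L] [Algebra S L] [IsScalarTower K S L] [Algebra.FormallyEtale S L]
    [AddCommGroup M] [Module K M] [Module S M] [Module L M] [IsScalarTower K S M]
    [IsScalarTower K L M] [IsScalarTower S L M] (D₀ : Derivation K S M) :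
    ∃ D : Derivation K L M, ∀ s, D (algebraMap S L s) = D₀ s := by
  let φ : L ⊗[S] Ω[S⁄K] →ₗ[L] M := D₀.liftKaehlerDifferential.liftBaseChange L
  let ψ := KaehlerDifferential.tensorKaehlerEquivOfFormallyEtale K S L
  refine ⟨(φ ∘ₗ ψ.symm.toLinearMap).compDer (KaehlerDifferential.D K L), fun s => ?_⟩
  have hψ : ψ.symm (KaehlerDifferential.D K L (algebraMap S L s)) =
      1 ⊗ₜ KaehlerDifferential.D K S s :=
    KaehlerDifferential.tensorKaehlerEquivOfFormallyEtale_symm_D_algebraMap K S L s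
  change φ (ψ.symm (KaehlerDifferential.D K L _)) = _
  rw [hψ, LinearMap.liftBaseChange_tmul, Derivation.liftKaehlerDifferential_comp_D, one_smul]

theorem formallyEtale_of_isAlgebraic (R L : Type*) [CommRing R] [CharZero R] [Field L]
    [Algebra R L] [FaithfulSMul R L] [Algebra.IsAlgebraic R L] : Algebra.FormallyEtale R L := by
  have : IsDomain R := (FaithfulSMul.algebraMap_injective R L).isDomain
  let : Algebra (FractionRing R) L := FractionRing.liftAlgebra R L
  have : Algebra.IsAlgebraic (FractionRing R) L :=
    (IsFractionRing.comap_isAlgebraic_iff (A := R)).1 inferInstance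
  have : Algebra.FormallyEtale R (FractionRing R) := .of_isLocalization (nonZeroDivisors R)
  have : Algebra.FormallyEtale (FractionRing R) L := .of_isSeparable _ L
  exact .comp R (FractionRing R) L

theorem exists_derivation_of_isTranscendenceBasis {K L ι : Type*} [CommRing K] [CharZero K]
    [Field L] [Algebra K L] {x : ι → L} (hx : IsTranscendenceBasis K x) (v : ι → L) :
    ∃ D : Derivation K L L, ∀ i, D (x i) = v i := by
  let : Algebra (MvPolynomial ι K) L := (MvPolynomial.aeval x).toAlgebra
  have : IsScalarTower K (MvPolynomial ι K) L :=
    .of_algebraMap_eq' (MvPolynomial.aeval x).comp_algebraMap.symm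
  have hinj : Function.Injective (algebraMap (MvPolynomial ι K) L) := hx.1
  have : FaithfulSMul (MvPolynomial ι K) L := (faithfulSMul_iff_algebraMap_injective _ _).2 hinj
  have : Algebra.IsAlgebraic (MvPolynomial ι K) L :=
    have := hx.isAlgebraic
    .of_ringHom_of_comp_eq hx.1.aevalEquiv (RingHom.id L) hx.1.aevalEquiv.surjective
      Function.injective_id (RingHom.ext fun f => (hx.1.algebraMap_aevalEquiv f).symm ▸ rfl)
  have := formallyEtale_of_isAlgebraic (MvPolynomial ι K) L
  obtain ⟨D, hD⟩ := exists_derivation_extending (L := L) (MvPolynomial.mkDerivation K v)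
  refine ⟨D, fun i => ?_⟩
  rw [← MvPolynomial.mkDerivation_X K v i, ← hD]
  congr 1
  exact (MvPolynomial.aeval_X x i).symm

theorem exists_derivation_of_algebraicIndependent {K L ι : Type*} [CommRing K] [CharZero K]
    [Field L] [Algebra K L] {x : ι → L} (hx : AlgebraicIndependent K x) (v : ι → L) :
    ∃ D : Derivation K L L, ∀ i, D (x i) = v i := by
  obtain ⟨B, hxB, hB⟩ := exists_isTranscendenceBasis_superset hx.to_subtype_range
  let incl : ι → B := fun i => ⟨x i, hxB ⟨i, rfl⟩⟩
  have hincl : Function.Injective incl := fun i j hij => hx.injective (congrArg Subtype.val hij)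
  obtain ⟨D, hD⟩ := exists_derivation_of_isTranscendenceBasis hB (Function.extend incl v 0)
  exact ⟨D, fun i => (hD (incl i)).trans (hincl.extend_apply v 0 i)⟩

section PolynomialMap

variable {K 𝕜 σ : Type*} [CommRing K] [NontriviallyNormedField 𝕜] [Algebra K 𝕜]

theorem hasStrictFDerivAt_aeval [Finite σ] (g : MvPolynomial σ K) (p : σ → 𝕜) :
    HasStrictFDerivAt (fun x : σ → 𝕜 => MvPolynomial.aeval x g)
      (fderiv 𝕜 (fun x : σ → 𝕜 => MvPolynomial.aeval x g) p) p :=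
  have := Fintype.ofFinite σ
  (AnalyticAt.aeval_mvPolynomial
    (fun i => (ContinuousLinearMap.proj i : (σ → 𝕜) →L[𝕜] 𝕜).analyticAt p) g).hasStrictFDerivAt

theorem fderiv_aeval_apply_derivation [Finite σ] (g : MvPolynomial σ K) (p : σ → 𝕜)
    (D : Derivation K 𝕜 𝕜) :
    fderiv 𝕜 (fun x : σ → 𝕜 => MvPolynomial.aeval x g) p (fun k => D (p k)) =
      D (MvPolynomial.aeval p g) := by
  have := Fintype.ofFinite σ
  have hasFDerivAt (g : MvPolynomial σ K) := (hasStrictFDerivAt_aeval g p).hasFDerivAt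
  induction g using MvPolynomial.induction_on with
  | C a => simp
  | add f g hf hg =>
    simp only [map_add]
    rw [((hasFDerivAt f).fun_add (hasFDerivAt g)).fderiv, ← hf, ← hg]
    rfl
  | mul_X f i hf =>
    simp only [map_mul, MvPolynomial.aeval_X]
    rw [(HasFDerivAt.fun_mul (E := σ → 𝕜) (hasFDerivAt f) (hasFDerivAt_apply i p)).fderiv]
    simp [hf]

theorem map_nhds_aeval_of_algebraicIndependent [CharZero K] [CompleteSpace 𝕜] [Finite σ]
    {J : Type*} [Finite J] {p : σ → 𝕜} {g : J → MvPolynomial σ K}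
    (hg : AlgebraicIndependent K fun j => MvPolynomial.aeval p (g j)) :
    map (fun (x : σ → 𝕜) j => MvPolynomial.aeval x (g j)) (𝓝 p) =
      𝓝 fun j => MvPolynomial.aeval p (g j) := by
  have := Fintype.ofFinite σ
  have := Fintype.ofFinite J
  refine (hasStrictFDerivAt_pi.2 fun j => hasStrictFDerivAt_aeval (g j) p).map_nhds_eq_of_surj
    (LinearMap.range_eq_top.2 fun y => ?_)
  -- By the chain rule, `D ∘ p` is a preimage of `y` under the differential.
  obtain ⟨D, hD⟩ := exists_derivation_of_algebraicIndependent hg y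
  exact ⟨fun k => D (p k), funext fun j => (fderiv_aeval_apply_derivation (g j) p D).trans (hD j)⟩

end PolynomialMap

theorem exists_algebraicIndependent_rat_real (ι : Type*) [Countable ι] :
    ∃ x : ι → ℝ, AlgebraicIndependent ℚ x := by
  obtain ⟨s, hs⟩ := exists_isTranscendenceBasis ℚ ℝ
  have : Infinite s := by
    by_contra hfin
    rw [not_infinite_iff_finite] at hfin
    have := hs.isAlgebraic_field
    have hF := IntermediateField.cardinalMk_adjoin_le ℚ (Set.range ((↑) : s → ℝ))
    have hR := Algebra.IsAlgebraic.cardinalMk_le_max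
      (IntermediateField.adjoin ℚ (Set.range ((↑) : s → ℝ))) ℝ
    rw [Subtype.range_coe, Cardinal.mkRat, max_eq_left (Cardinal.mk_le_aleph0 (α := s)),
      max_self] at hF
    rw [Cardinal.mk_real, Subtype.range_coe, max_eq_right hF] at hR
    exact Cardinal.aleph0_lt_continuum.not_ge hR
  obtain ⟨f, hf⟩ := Countable.exists_injective_nat ι
  exact ⟨_, hs.1.comp (fun i => Infinite.natEmbedding s (f i))
    ((Infinite.natEmbedding s).injective.comp hf)⟩

theorem dense_setOf_algebraicIndependent_rat_real (ι : Type*) [Countable ι] :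
    Dense {x : ι → ℝ | AlgebraicIndependent ℚ x} := by
  obtain ⟨b, hb⟩ := exists_algebraicIndependent_rat_real ι
  have hdense : DenseRange fun (r : ι → ℚ) i => b i + (r i : ℝ) :=
    DenseRange.piMap fun i => (Homeomorph.addLeft (b i)).surjective.denseRange.comp
      Rat.denseRange_cast (Homeomorph.addLeft (b i)).continuous
  refine hdense.mono ?_
  rintro _ ⟨r, rfl⟩
  have htrans (i : ι) : Transcendental ℚ (X + C (r i)) :=
    Polynomial.transcendental _ (by simp) (by simp)
  simpa using hb.polynomial_aeval_of_transcendental htrans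

section Specialization

variable {K A E : Type*}

/-- The univariate polynomial obtained by substituting `y` for the parameters of a polynomial `P`
whose coefficients are polynomials in parameters indexed by `E`. A polynomial relation between
elements `s` and `y e` is encoded as `P` with `(specialize y P).eval s = 0`. -/
noncomputable def specialize [CommSemiring K] [CommSemiring A] [Algebra K A] (y : E → A)
    (P : (MvPolynomial E K)[X]) : A[X] :=
  P.map (MvPolynomial.aeval y : MvPolynomial E K →ₐ[K] A).toRingHom

theorem derivative_specialize [CommSemiring K] [CommSemiring A] [Algebra K A] (y : E → A)
    (P : (MvPolynomial E K)[X]) : derivative (specialize y P) = specialize y (derivative P) :=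
  derivative_map P _

theorem map_eval_specialize {B : Type*} [CommSemiring K] [CommSemiring A] [CommSemiring B]
    [Algebra K A] [Algebra K B] (φ : A →ₐ[K] B) (y : E → A) (P : (MvPolynomial E K)[X]) (s : A) :
    φ ((specialize y P).eval s) = (specialize (φ ∘ y) P).eval (φ s) := by
  have hmap : specialize (φ ∘ y) P = (specialize y P).map φ.toRingHom := by
    rw [specialize, specialize, Polynomial.map_map]
    exact congrArg (fun ψ : MvPolynomial E K →ₐ[K] B => P.map ψ.toRingHom)
      (MvPolynomial.comp_aeval y φ).symm
  rw [hmap]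
  exact (eval_map_apply φ.toRingHom s).symm

theorem eval_specialize_eq_zero_of_algebraicIndependent {σ B : Type*} [CommRing K] [CommRing A]
    [CommRing B] [Algebra K A] [Algebra K B] {p : σ → A} (hp : AlgebraicIndependent K p)
    {f : E → MvPolynomial σ K} {t : MvPolynomial σ K} {P : (MvPolynomial E K)[X]}
    (h : (specialize (fun e => MvPolynomial.aeval p (f e)) P).eval (MvPolynomial.aeval p t) = 0)
    (q : σ → B) :
    (specialize (fun e => MvPolynomial.aeval q (f e)) P).eval (MvPolynomial.aeval q t) = 0 := by
  have hzero : (specialize f P).eval t = 0 :=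
    hp.eq_zero_of_aeval_eq_zero _ ((map_eval_specialize (MvPolynomial.aeval p) f P t).trans h)
  refine (map_eval_specialize (MvPolynomial.aeval q) f P t).symm.trans ?_
  rw [hzero, map_zero]

theorem continuous_aeval {σ : Type*} [CommSemiring K] [CommSemiring A] [Algebra K A]
    [TopologicalSpace A] [IsTopologicalSemiring A] (g : MvPolynomial σ K) :
    Continuous fun x : σ → A => MvPolynomial.aeval x g := by
  simp_rw [MvPolynomial.aeval_def, MvPolynomial.eval₂_eq_eval_map]
  exact MvPolynomial.continuous_eval _

theorem continuous_eval_specialize [CommSemiring K] [CommSemiring A] [Algebra K A]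
    [TopologicalSpace A] [IsTopologicalSemiring A] (P : (MvPolynomial E K)[X]) :
    Continuous fun z : (E → A) × A => (specialize z.1 P).eval z.2 := by
  simp_rw [specialize, eval_map, eval₂_eq_sum_range]
  exact continuous_finsetSum _ fun i _ =>
    ((continuous_aeval (P.coeff i)).comp continuous_fst).mul (continuous_snd.pow i)

theorem exists_separable_map_of_isAlgebraic {R L : Type*} [CommRing R] [CharZero R] [Field L]
    [Algebra R L] [FaithfulSMul R L] {s : L} (hs : IsAlgebraic R s) :
    ∃ Q : R[X], aeval s Q = 0 ∧ (Q.map (algebraMap R L)).Separable := by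
  have : IsDomain R := (FaithfulSMul.algebraMap_injective R L).isDomain
  let : Algebra (FractionRing R) L := FractionRing.liftAlgebra R L
  have hint : IsIntegral (FractionRing R) s :=
    ((IsFractionRing.isAlgebraic_iff R (FractionRing R) L).1 hs).isIntegral
  obtain ⟨b, hb, hQ⟩ :=
    IsLocalization.integerNormalization_spec (nonZeroDivisors R) (minpoly (FractionRing R) s)
  set Q := IsLocalization.integerNormalization (nonZeroDivisors R) (minpoly (FractionRing R) s)
  have hQL : Q.map (algebraMap R L) =
      C (algebraMap R L b) * (minpoly (FractionRing R) s).map (algebraMap _ L) := by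
    rw [IsScalarTower.algebraMap_eq R (FractionRing R) L, ← Polynomial.map_map, hQ,
      algebra_compatible_smul (FractionRing R) b, smul_eq_C_mul, Polynomial.map_mul, map_C]
    rfl
  have hb : algebraMap R L b ≠ 0 := by
    simpa using nonZeroDivisors.ne_zero hb
  refine ⟨Q, ?_, ?_⟩
  · rw [aeval_def, ← eval_map, hQL, eval_mul, eval_map_algebraMap, minpoly.aeval, mul_zero]
  · rw [hQL]
    exact .unit_mul (isUnit_C.2 hb.isUnit) (minpoly.irreducible hint).separable.map

theorem exists_separable_specialize_of_isAlgebraic {L : Type*} [Field K] [CharZero K] [Field L]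
    [Algebra K L] {y : E → L} {s : L} (hs : IsAlgebraic (Algebra.adjoin K (Set.range y)) s) :
    ∃ P : (MvPolynomial E K)[X], (specialize y P).eval s = 0 ∧ (specialize y P).Separable := by
  rw [Algebra.adjoin_range_eq_range_aeval] at hs
  have : CharZero (MvPolynomial.aeval y : MvPolynomial E K →ₐ[K] L).range :=
    charZero_of_injective_algebraMap (algebraMap K _).injective
  obtain ⟨Q, hroot, hsep⟩ := exists_separable_map_of_isAlgebraic hs
  obtain ⟨P, rfl⟩ := map_surjective _ (MvPolynomial.aeval y).rangeRestrict_surjective Q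
  have hP : specialize y P = (P.map (MvPolynomial.aeval y).rangeRestrict.toRingHom).map
      (algebraMap (MvPolynomial.aeval y).range L) := by
    rw [Polynomial.map_map]
    rfl
  refine ⟨P, ?_, hP ▸ hsep⟩
  rw [hP, eval_map_algebraMap]
  exact hroot

theorem injOn_eval_of_derivative_ne_zero {Q : ℝ[X]} {I : Set ℝ} [I.OrdConnected]
    (hQ : ∀ x ∈ I, Q.derivative.eval x ≠ 0) : I.InjOn Q.eval := by
  intro s hs t ht hst
  by_contra hne
  wlog hlt : s < t generalizing s t
  · exact this ht hs hst.symm (Ne.symm hne) (lt_of_le_of_ne (not_lt.1 hlt) (Ne.symm hne))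
  obtain ⟨x, hx, hx0⟩ := exists_deriv_eq_zero hlt Q.continuousOn hst
  exact hQ x (Set.Icc_subset I hs ht (Set.Ioo_subset_Icc_self hx)) (Q.deriv ▸ hx0)

theorem exists_mem_nhds_eventually_injOn_eval_specialize [CommSemiring K] [Algebra K ℝ]
    {P : (MvPolynomial E K)[X]} {y₀ : E → ℝ} {s₀ : ℝ}
    (h : (derivative (specialize y₀ P)).eval s₀ ≠ 0) :
    ∃ I ∈ 𝓝 s₀, ∀ᶠ y in 𝓝 y₀, Set.InjOn (specialize y P).eval I := by
  rw [derivative_specialize] at h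
  have hev := ((continuous_eval_specialize (derivative P)).tendsto (y₀, s₀)).eventually_ne h
  rw [nhds_prod_eq] at hev
  obtain ⟨Y, hY, B, hB, hne⟩ := eventually_prod_iff.1 hev
  obtain ⟨η, hη, hball⟩ := Metric.eventually_nhds_iff_ball.1 hB
  have : (Metric.ball s₀ η).OrdConnected := Real.ball_eq_Ioo s₀ η ▸ Set.ordConnected_Ioo
  refine ⟨Metric.ball s₀ η, Metric.ball_mem_nhds s₀ hη, hY.mono fun y hy => ?_⟩
  exact injOn_eval_of_derivative_ne_zero fun x hx => derivative_specialize y P ▸ hne hy (hball x hx)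

end Specialization

theorem exists_algebraicIndepOn {R A E : Type*} [CommRing R] [CommRing A] [IsDomain A]
    [Algebra R A] [FaithfulSMul R A] (y : E → A) :
    ∃ I : Set E, AlgebraicIndepOn R y I ∧ ∀ a : A,
      IsAlgebraic (Algebra.adjoin R (y '' I)) a ↔
        IsAlgebraic (Algebra.adjoin R (Set.range y)) a := by
  obtain ⟨I, hI⟩ := ((AlgebraicIndependent.matroid R A).comap y).exists_isBasis Set.univ
  rw [Matroid.comap_isBasis_iff, Set.image_univ] at hI
  obtain ⟨hbasis, hinj, -⟩ := hI
  refine ⟨I, ?_, fun a => AlgebraicIndependent.isAlgebraic_adjoin_iff_of_matroid_isBasis hbasis⟩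
  exact (algebraicIndependent_image hinj).2 (AlgebraicIndependent.matroid_indep_iff.1 hbasis.indep)

section AlgebraicDependence

variable {K 𝕜 σ E : Type*} [Field K] [CharZero K]

theorem eventually_aeval_eq_of_isAlgebraic [Field 𝕜] [TopologicalSpace 𝕜] [IsTopologicalRing 𝕜]
    [T1Space 𝕜] [Algebra K 𝕜] {p : σ → 𝕜} (hp : AlgebraicIndependent K p)
    {f : E → MvPolynomial σ K} {t : MvPolynomial σ K}
    (ht : IsAlgebraic (Algebra.adjoin K (Set.range fun e => MvPolynomial.aeval p (f e)))
      (MvPolynomial.aeval p t)) :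
    ∀ᶠ q in 𝓝 p, (∀ e, MvPolynomial.aeval q (f e) = MvPolynomial.aeval p (f e)) →
      MvPolynomial.aeval q t = MvPolynomial.aeval p t := by
  obtain ⟨P, hroot, hsep⟩ := exists_separable_specialize_of_isAlgebraic ht
  set Q := specialize (fun e => MvPolynomial.aeval p (f e)) P with hQ
  have hfin : (Q.rootSet 𝕜 \ {MvPolynomial.aeval p t}).Finite := (Q.rootSet_finite 𝕜).sdiff
  have havoid : ∀ᶠ q in 𝓝 p,
      MvPolynomial.aeval q t ∉ Q.rootSet 𝕜 \ {MvPolynomial.aeval p t} :=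
    (continuous_aeval t).continuousAt.preimage_mem_nhds
      (hfin.isClosed.isOpen_compl.mem_nhds (by simp))
  filter_upwards [havoid] with q hq hfiber
  by_contra hne
  refine hq ⟨(mem_rootSet_of_ne hsep.ne_zero).2 ?_, hne⟩
  have hrootq := eval_specialize_eq_zero_of_algebraicIndependent hp hroot q
  rwa [funext hfiber, ← hQ, ← coe_aeval_eq_eval] at hrootq

variable [NontriviallyNormedField 𝕜] [CompleteSpace 𝕜] [Algebra K 𝕜] [Finite σ] [Finite E]
  {p : σ → 𝕜} {f : E → MvPolynomial σ K} {t : MvPolynomial σ K}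

theorem isAlgebraic_of_eventually_aeval_eq_of_algebraicIndependent
    (hf : AlgebraicIndependent K fun e => MvPolynomial.aeval p (f e))
    (ht : ∀ᶠ q in 𝓝 p, (∀ e, MvPolynomial.aeval q (f e) = MvPolynomial.aeval p (f e)) →
      MvPolynomial.aeval q t = MvPolynomial.aeval p t) :
    IsAlgebraic (Algebra.adjoin K (Set.range fun e => MvPolynomial.aeval p (f e)))
      (MvPolynomial.aeval p t) := by
  -- Otherwise the map defined by `t` and `f` is open at `p`, so `t` varies while `f` is fixed.
  by_contra htrans
  classical
  let g : Option E → MvPolynomial σ K := fun o => o.elim t f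
  have hg : AlgebraicIndependent K fun j => MvPolynomial.aeval p (g j) := by
    convert (hf.option_iff_transcendental (MvPolynomial.aeval p t)).2 htrans using 2 with j
    cases j <;> rfl
  have hvalues : ∀ᶠ w in 𝓝 fun j => MvPolynomial.aeval p (g j),
      (∀ e, w (some e) = MvPolynomial.aeval p (f e)) → w none = MvPolynomial.aeval p t := by
    rw [← map_nhds_aeval_of_algebraicIndependent hg, eventually_map]
    exact ht
  have hupdate : Continuous fun s : 𝕜 =>
      Function.update (fun j => MvPolynomial.aeval p (g j)) none s :=
    continuous_const.update none continuous_id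
  have hisolated : ∀ᶠ s in 𝓝 (MvPolynomial.aeval p t), s = MvPolynomial.aeval p t := by
    filter_upwards [hupdate.tendsto' _ _ (Function.update_eq_self none _) hvalues] with s hs
    simpa [g] using hs
  exact infinite_of_mem_nhds _ hisolated (Set.finite_singleton _)

theorem isAlgebraic_of_eventually_aeval_eq (hp : AlgebraicIndependent K p)
    (ht : ∀ᶠ q in 𝓝 p, (∀ e, MvPolynomial.aeval q (f e) = MvPolynomial.aeval p (f e)) →
      MvPolynomial.aeval q t = MvPolynomial.aeval p t) :
    IsAlgebraic (Algebra.adjoin K (Set.range fun e => MvPolynomial.aeval p (f e)))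
      (MvPolynomial.aeval p t) := by
  let y : E → 𝕜 := fun e => MvPolynomial.aeval p (f e)
  obtain ⟨I, hI, hadjoin⟩ := exists_algebraicIndepOn (R := K) y
  have hfiber : ∀ᶠ q in 𝓝 p, ∀ e,
      (∀ i : I, MvPolynomial.aeval q (f i) = MvPolynomial.aeval p (f i)) →
        MvPolynomial.aeval q (f e) = MvPolynomial.aeval p (f e) :=
    eventually_all.2 fun e => eventually_aeval_eq_of_isAlgebraic hp <| by
      rw [← Set.image_eq_range y I, hadjoin]
      exact isAlgebraic_algebraMap
        (⟨y e, Algebra.subset_adjoin ⟨e, rfl⟩⟩ : Algebra.adjoin K (Set.range y))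
  rw [← hadjoin, Set.image_eq_range]
  refine isAlgebraic_of_eventually_aeval_eq_of_algebraicIndependent hI ?_
  filter_upwards [ht, hfiber] with q ht hfiber hq
  exact ht fun e => hfiber e hq

end AlgebraicDependence

section Frameworks

variable {V : Type*} {d : ℕ}

theorem Equivalent.refl (G : SimpleGraph V) (p : Realization V d) : Equivalent G p p :=
  fun _ _ _ => rfl

theorem Equivalent.trans {G : SimpleGraph V} {p q r : Realization V d} (h : Equivalent G p q)
    (h' : Equivalent G q r) : Equivalent G p r := fun x y hxy => (h x y hxy).trans (h' x y hxy)

/-- The family of coordinates of a realization. It identifies the space of realizations with the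
space in which `IsGeneric` asks for algebraic independence. -/
noncomputable def coords : Realization V d ≃ₜ (V × Fin d → ℝ) where
  toFun p c := p c.1 c.2
  invFun y x := WithLp.toLp 2 fun i => y (x, i)
  left_inv _ := rfl
  right_inv _ := rfl
  continuous_toFun := by fun_prop
  continuous_invFun := by fun_prop

theorem dense_setOf_isGeneric [Countable V] : Dense {p : Realization V d | IsGeneric p} :=
  (dense_setOf_algebraicIndependent_rat_real (V × Fin d)).preimage coords.isOpenMap

/-- The squared distance of two vertices, as a polynomial in the coordinates of a realization. -/
noncomputable def sqDistPoly (d : ℕ) (x y : V) : MvPolynomial (V × Fin d) ℚ :=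
  ∑ i, (MvPolynomial.X (x, i) - MvPolynomial.X (y, i)) ^ 2

theorem aeval_sqDistPoly (p : Realization V d) (x y : V) :
    MvPolynomial.aeval (coords p) (sqDistPoly d x y) = ‖p x - p y‖ ^ 2 := by
  simp [sqDistPoly, EuclideanSpace.real_norm_sq_eq, coords]

theorem continuous_norm_sub (x y : V) : Continuous fun q : Realization V d => ‖q x - q y‖ := by
  fun_prop

/-- The family of squared edge lengths of a framework. Edges are indexed by darts, so each of them
occurs twice. -/
noncomputable def sqEdgeLengths (G : SimpleGraph V) (q : Realization V d) : G.Dart → ℝ :=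
  fun e => ‖q e.fst - q e.snd‖ ^ 2

theorem sqEdgeLengths_eq_aeval (G : SimpleGraph V) (q : Realization V d) :
    sqEdgeLengths G q = fun e => MvPolynomial.aeval (coords q) (sqDistPoly d e.fst e.snd) :=
  funext fun e => (aeval_sqDistPoly q e.fst e.snd).symm

theorem continuous_sqEdgeLengths (G : SimpleGraph V) :
    Continuous (sqEdgeLengths (d := d) G) :=
  continuous_pi fun e => (continuous_norm_sub e.fst e.snd).pow 2

theorem equivalent_iff_sqEdgeLengths_eq {G : SimpleGraph V} {p q : Realization V d} :
    Equivalent G p q ↔ sqEdgeLengths G p = sqEdgeLengths G q := by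
  refine ⟨fun h => funext fun e => congrArg (· ^ 2) (h _ _ e.adj), fun h x y hxy => ?_⟩
  exact (sq_eq_sq₀ (norm_nonneg _) (norm_nonneg _)).1 (congrFun h ⟨(x, y), hxy⟩)

/-- The pair `{u, v}` is locally linked in the framework `(G, p)`: its distance is the same in all
equivalent frameworks close to `p`. This is the local version of `GloballyLinkedIn`. -/
def LocallyLinkedIn (G : SimpleGraph V) (p : Realization V d) (u v : V) : Prop :=
  ∀ᶠ q in 𝓝 p, Equivalent G p q → ‖p u - p v‖ = ‖q u - q v‖

theorem IsRigidFramework.locallyLinkedIn [Finite V] {G : SimpleGraph V} {p : Realization V d}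
    (h : IsRigidFramework G p) (u v : V) : LocallyLinkedIn G p u v := by
  obtain ⟨ε, hε, hrigid⟩ := h
  have hnear : ∀ᶠ q in 𝓝 p, ∀ x, ‖p x - q x‖ < ε := eventually_all.2 fun x =>
    (by fun_prop : Continuous fun q : Realization V d => ‖p x - q x‖).continuousAt.eventually_lt
      continuousAt_const (by simpa using hε)
  exact hnear.mono fun q hq hpq => hrigid q hpq hq u v

theorem LocallyLinkedIn.isAlgebraic [Finite V] {G : SimpleGraph V} {p : Realization V d} {u v : V}
    (h : LocallyLinkedIn G p u v) (hp : IsGeneric p) :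
    IsAlgebraic (Algebra.adjoin ℚ (Set.range (sqEdgeLengths G p))) (‖p u - p v‖ ^ 2) := by
  have : Finite G.Dart := .of_injective _ SimpleGraph.Dart.toProd_injective
  have hlocal : ∀ᶠ y in 𝓝 (coords p),
      (∀ e : G.Dart, MvPolynomial.aeval y (sqDistPoly d e.fst e.snd) =
        MvPolynomial.aeval (coords p) (sqDistPoly d e.fst e.snd)) →
      MvPolynomial.aeval y (sqDistPoly d u v) =
        MvPolynomial.aeval (coords p) (sqDistPoly d u v) := by
    rw [← coords.map_nhds_eq, eventually_map]
    filter_upwards [h] with q hq hedges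
    simp only [aeval_sqDistPoly] at hedges ⊢
    rw [hq (equivalent_iff_sqEdgeLengths_eq.2 (funext hedges).symm)]
  rw [sqEdgeLengths_eq_aeval, ← aeval_sqDistPoly]
  exact isAlgebraic_of_eventually_aeval_eq hp hlocal

theorem LocallyLinkedIn.exists_separable_specialize [Finite V] {G : SimpleGraph V}
    {p : Realization V d} {u v : V} (h : LocallyLinkedIn G p u v) (hp : IsGeneric p) :
    ∃ P : (MvPolynomial G.Dart ℚ)[X], (specialize (sqEdgeLengths G p) P).Separable ∧
      ∀ q : Realization V d, (specialize (sqEdgeLengths G q) P).eval (‖q u - q v‖ ^ 2) = 0 := by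
  obtain ⟨P, hroot, hsep⟩ := exists_separable_specialize_of_isAlgebraic (h.isAlgebraic hp)
  refine ⟨P, hsep, fun q => ?_⟩
  rw [sqEdgeLengths_eq_aeval, ← aeval_sqDistPoly] at hroot ⊢
  exact eval_specialize_eq_zero_of_algebraicIndependent hp hroot (coords q)

theorem finite_norm_sub_of_eval_specialize_eq_zero {G : SimpleGraph V} {p : Realization V d}
    {u v : V} {P : (MvPolynomial G.Dart ℚ)[X]} (hP : specialize (sqEdgeLengths G p) P ≠ 0)
    (hroot : ∀ q : Realization V d,
      (specialize (sqEdgeLengths G q) P).eval (‖q u - q v‖ ^ 2) = 0) :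
    ((fun q => ‖q u - q v‖) '' {q | Equivalent G p q}).Finite := by
  refine .of_finite_image (f := (· ^ 2))
    (((specialize (sqEdgeLengths G p) P).rootSet_finite ℝ).subset ?_) ?_
  · rintro _ ⟨_, ⟨q, hpq, rfl⟩, rfl⟩
    refine (mem_rootSet_of_ne hP).2 ?_
    rw [coe_aeval_eq_eval, equivalent_iff_sqEdgeLengths_eq.1 hpq]
    exact hroot q
  · rintro _ ⟨q, -, rfl⟩ _ ⟨r, -, rfl⟩ hqr
    exact (sq_eq_sq₀ (norm_nonneg _) (norm_nonneg _)).1 hqr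

theorem LocallyLinkedIn.exists_equivalent_forall_norm_sub_le [Finite V] {G : SimpleGraph V}
    {p : Realization V d} {u v : V} (h : LocallyLinkedIn G p u v) (hp : IsGeneric p) :
    ∃ q₀, Equivalent G p q₀ ∧ ∀ q, Equivalent G p q → ‖q₀ u - q₀ v‖ ≤ ‖q u - q v‖ := by
  obtain ⟨P, hsep, hroot⟩ := h.exists_separable_specialize hp
  obtain ⟨_, ⟨q₀, hq₀, rfl⟩, hmin⟩ := Set.exists_min_image _ id
    (finite_norm_sub_of_eval_specialize_eq_zero hsep.ne_zero hroot) ⟨_, p, .refl G p, rfl⟩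
  exact ⟨q₀, hq₀, fun q hq => hmin _ ⟨q, hq, rfl⟩⟩

/-- The total length of a walk in a realization. -/
noncomputable def walkLength {G : SimpleGraph V} {u v : V} (P : G.Walk u v)
    (q : Realization V d) : ℝ :=
  (P.darts.map fun e => ‖q e.fst - q e.snd‖).sum

section WalkLength

variable {G : SimpleGraph V} {u v w : V}

theorem walkLength_nil (q : Realization V d) : walkLength (.nil : G.Walk u u) q = 0 := rfl

theorem walkLength_cons (h : G.Adj u v) (P : G.Walk v w) (q : Realization V d) :
    walkLength (.cons h P) q = ‖q u - q v‖ + walkLength P q := by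
  simp [walkLength]

theorem continuous_walkLength (P : G.Walk u v) : Continuous (walkLength (d := d) P) :=
  continuous_list_sum _ fun e _ => continuous_norm_sub e.fst e.snd

theorem Equivalent.walkLength_eq {p q : Realization V d} (h : Equivalent G p q)
    (P : G.Walk u v) : walkLength P p = walkLength P q :=
  congrArg List.sum (List.map_congr_left fun e _ => h _ _ e.adj)

theorem norm_sub_le_walkLength (P : G.Walk u v) (q : Realization V d) :
    ‖q u - q v‖ ≤ walkLength P q := by
  induction P with
  | nil => simp [walkLength_nil]
  | cons h P ih =>
    rw [walkLength_cons]
    exact (norm_sub_le_norm_sub_add_norm_sub _ _ _).trans (by gcongr)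

theorem walkLength_le_length_mul {q : Realization V d} {M : ℝ}
    (hM : ∀ x y, G.Adj x y → ‖q x - q y‖ ≤ M) (P : G.Walk u v) :
    walkLength P q ≤ P.length * M := by
  have hdarts : ∀ l ∈ P.darts.map fun e => ‖q e.fst - q e.snd‖, l ≤ M := by
    simp only [List.forall_mem_map]
    exact fun e _ => hM _ _ e.adj
  simpa [walkLength] using! List.sum_le_card_nsmul _ M hdarts

theorem walkLength_eq_norm_sub {P : G.Walk u v} (hP : P.IsPath) {q : Realization V d}
    {z : EuclideanSpace ℝ (Fin d)} (hq : ∀ w ∈ P.support, w ≠ v → q w = z) :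
    walkLength P q = ‖q u - q v‖ := by
  induction P with
  | nil => simp [walkLength_nil]
  | @cons a b c hab P ih =>
    rw [SimpleGraph.Walk.cons_isPath_iff] at hP
    have hac : a ≠ c := fun h => hP.2 (h ▸ P.end_mem_support)
    have ih := ih hP.1 fun w hw => hq w (by simp [hw])
    have ha : q a = z := hq a (by simp) hac
    rw [walkLength_cons, ih]
    by_cases hbc : b = c
    · simp [hbc]
    · simp [ha, hq b (by simp) hbc]

theorem IsInternallyDisjointPath.exists_extension_walkLength_eq {P : G.Walk u v} {X : Set V}
    (hP : IsInternallyDisjointPath P X) (hu : u ∈ X) (hv : v ∈ X) (q : Realization X d) :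
    ∃ p : Realization V d, X.domRestrict p = q ∧ walkLength P p = ‖q ⟨u, hu⟩ - q ⟨v, hv⟩‖ := by
  classical
  let p : Realization V d := fun x => if h : x ∈ X then q ⟨x, h⟩ else q ⟨u, hu⟩
  have hp (w) (hw : w ∈ P.support) (hwv : w ≠ v) : p w = q ⟨u, hu⟩ := by
    obtain rfl | hwu := eq_or_ne w u
    · exact dif_pos hu
    · exact dif_neg (hP.2 w hw hwu hwv)
  refine ⟨p, funext fun x => dif_pos x.2, ?_⟩
  rw [walkLength_eq_norm_sub hP.1 hp, show p u = _ from dif_pos hu, show p v = _ from dif_pos hv]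

end WalkLength

theorem exists_equivalent_norm_le [Finite V] {G : SimpleGraph V} {q : Realization V d} {M : ℝ}
    (hM : 0 ≤ M) (hq : ∀ x y, G.Adj x y → ‖q x - q y‖ ≤ M) :
    ∃ r, Equivalent G q r ∧ ∀ x, ‖r x‖ ≤ Nat.card V * M := by
  classical
  have := Fintype.ofFinite V
  let root (x : V) : V := (G.connectedComponentMk x).out
  refine ⟨fun x => q x - q (root x), fun x y hxy => ?_, fun x => ?_⟩
  · have hroot : root x = root y :=
      congrArg Quot.out (SimpleGraph.ConnectedComponent.sound hxy.reachable)
    simp [hroot]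
  · have hreach : G.Reachable x (root x) :=
      SimpleGraph.ConnectedComponent.exact (G.connectedComponentMk x).out_eq.symm
    obtain ⟨P, hP⟩ := hreach.exists_isPath
    calc ‖q x - q (root x)‖ ≤ walkLength P q := norm_sub_le_walkLength P q
      _ ≤ P.length * M := walkLength_le_length_mul hq P
      _ ≤ Nat.card V * M := by
        rw [Nat.card_eq_fintype_card]
        gcongr
        exact hP.length_lt.le

theorem isClosed_setOf_equivalent (G : SimpleGraph V) :
    IsClosed {z : Realization V d × Realization V d | Equivalent G z.1 z.2} := by
  simp only [equivalent_iff_sqEdgeLengths_eq]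
  exact isClosed_eq ((continuous_sqEdgeLengths G).comp continuous_fst)
    ((continuous_sqEdgeLengths G).comp continuous_snd)

theorem exists_equivalent_norm_le_of_norm_sub_le [Finite V] {G : SimpleGraph V}
    {q : Realization V d} {u v : V} {M : ℝ} (hM : 0 ≤ M)
    (hq : ∀ x y, G.Adj x y → ‖q x - q y‖ ≤ M) (huv : ‖q u - q v‖ ≤ M) :
    ∃ r, Equivalent G q r ∧ ‖q u - q v‖ = ‖r u - r v‖ ∧ ∀ x, ‖r x‖ ≤ Nat.card V * M := by
  -- Translating components of `G` could change `‖q u - q v‖`, hence the additional edge.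
  obtain ⟨r, hr, hbound⟩ := exists_equivalent_norm_le (G := G ⊔ SimpleGraph.edge u v) hM
    (q := q) fun x y hxy => by
      rcases hxy with hxy | hxy
      · exact hq x y hxy
      · obtain ⟨⟨rfl, rfl⟩ | ⟨rfl, rfl⟩, -⟩ := (SimpleGraph.edge_adj ..).1 hxy
        · exact huv
        · rwa [norm_sub_rev]
  refine ⟨r, fun x y hxy => hr x y (Or.inl hxy), ?_, hbound⟩
  obtain rfl | huv := eq_or_ne u v
  · simp
  · exact hr u v (Or.inr (by simp [SimpleGraph.edge_adj, huv]))

theorem eventually_forall_equivalent_lt_norm_sub [Finite V] {G : SimpleGraph V}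
    {q₀ : Realization V d} {u v : V} {a : ℝ} (h : ∀ q, Equivalent G q₀ q → a < ‖q u - q v‖) :
    ∀ᶠ q' in 𝓝 q₀, ∀ q, Equivalent G q' q → a < ‖q u - q v‖ := by
  obtain ⟨B, hB⟩ := (Set.finite_range fun z : V × V => ‖q₀ z.1 - q₀ z.2‖).bddAbove
  have hdist : ∀ᶠ q' in 𝓝 q₀, ∀ z : V × V, ‖q' z.1 - q' z.2‖ < B + 1 :=
    eventually_all.2 fun z => (continuous_norm_sub z.1 z.2).continuousAt.eventually_lt
      continuousAt_const ((hB ⟨z, rfl⟩).trans_lt (lt_add_one B))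
  let M := max a (max (B + 1) 0)
  let S : Set (Realization V d) := Set.univ.pi fun _ => Metric.closedBall 0 (Nat.card V * M)
  have hS : IsCompact S := isCompact_univ_pi fun _ => isCompact_closedBall _ _
  have hclosed : IsClosed {z : Realization V d × Realization V d |
      Equivalent G z.1 z.2 ∧ ‖z.2 u - z.2 v‖ ≤ a} :=
    (isClosed_setOf_equivalent G).inter
      (isClosed_le ((continuous_norm_sub u v).comp continuous_snd) continuous_const)
  have hcompact : ∀ᶠ q' in 𝓝 q₀, ∀ r ∈ S, ¬ (Equivalent G q' r ∧ ‖r u - r v‖ ≤ a) :=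
    hS.eventually_forall_of_forall_eventually fun r _ =>
      hclosed.isOpen_compl.mem_nhds fun hr => (h r hr.1).not_ge hr.2
  filter_upwards [hdist, hcompact] with q' hq' hS' q hq
  by_contra! hle
  obtain ⟨r, hr, hruv, hbound⟩ := exists_equivalent_norm_le_of_norm_sub_le (M := M) (by simp [M])
    (fun x y hxy => (hq x y hxy).symm.le.trans ((hq' (x, y)).le.trans (by simp [M])))
    (hle.trans (le_max_left _ _))
  exact hS' r (fun x _ => mem_closedBall_zero_iff.2 (hbound x)) ⟨hq.trans hr, hruv ▸ hle⟩

theorem exists_eventually_norm_sub_eq_of_derivative_ne_zero [Finite V] {G : SimpleGraph V}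
    {q₀ : Realization V d} {u v : V} {P : (MvPolynomial G.Dart ℚ)[X]}
    (hsimple : (derivative (specialize (sqEdgeLengths G q₀) P)).eval (‖q₀ u - q₀ v‖ ^ 2) ≠ 0)
    (hroot : ∀ q : Realization V d,
      (specialize (sqEdgeLengths G q) P).eval (‖q u - q v‖ ^ 2) = 0)
    (hmin : ∀ q, Equivalent G q₀ q → ‖q₀ u - q₀ v‖ ≤ ‖q u - q v‖) :
    ∃ a, ‖q₀ u - q₀ v‖ < a ∧ ∀ᶠ q' in 𝓝 q₀, ∀ q, Equivalent G q' q → ‖q u - q v‖ < a →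
      ‖q' u - q' v‖ = ‖q u - q v‖ := by
  obtain ⟨I, hI, hinj⟩ := exists_mem_nhds_eventually_injOn_eval_specialize hsimple
  obtain ⟨δ, hδ, hsq⟩ := Metric.eventually_nhds_iff_ball.1
    ((continuous_pow 2).continuousAt.preimage_mem_nhds hI)
  have hlower := eventually_forall_equivalent_lt_norm_sub (a := ‖q₀ u - q₀ v‖ - δ)
    fun q hq => (sub_lt_self _ hδ).trans_le (hmin q hq)
  have hupper : ∀ᶠ q' in 𝓝 q₀, ‖q' u - q' v‖ < ‖q₀ u - q₀ v‖ + δ :=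
    (continuous_norm_sub u v).continuousAt.eventually_lt continuousAt_const
      (lt_add_of_pos_right _ hδ)
  refine ⟨_, lt_add_of_pos_right _ hδ, ?_⟩
  filter_upwards [hlower, hupper, (continuous_sqEdgeLengths G).tendsto q₀ hinj]
    with q' hlower hupper hinj q hq hlt
  have hmem (r : Realization V d) (hr : Equivalent G q' r)
      (hlt : ‖r u - r v‖ < ‖q₀ u - q₀ v‖ + δ) : ‖r u - r v‖ ^ 2 ∈ I :=
    hsq _ (Real.ball_eq_Ioo _ _ ▸ ⟨hlower r hr, hlt⟩)
  have hrootq : (specialize (sqEdgeLengths G q') P).eval (‖q u - q v‖ ^ 2) = 0 :=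
    equivalent_iff_sqEdgeLengths_eq.1 hq ▸ hroot q
  exact (sq_eq_sq₀ (norm_nonneg _) (norm_nonneg _)).1 <|
    hinj (hmem q' (.refl G q') hupper) (hmem q hq hlt) ((hroot q').trans hrootq.symm)

theorem LocallyLinkedIn.exists_eventually_norm_sub_eq [Finite V] {G : SimpleGraph V}
    {p : Realization V d} {u v : V} (h : LocallyLinkedIn G p u v) (hp : IsGeneric p) :
    ∃ (q₀ : Realization V d) (a : ℝ), ‖q₀ u - q₀ v‖ < a ∧ ∀ᶠ q' in 𝓝 q₀, ∀ q,
      Equivalent G q' q → ‖q u - q v‖ < a → ‖q' u - q' v‖ = ‖q u - q v‖ := by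
  obtain ⟨P, hsep, hroot⟩ := h.exists_separable_specialize hp
  obtain ⟨q₀, hq₀, hmin⟩ := h.exists_equivalent_forall_norm_sub_le hp
  rw [equivalent_iff_sqEdgeLengths_eq.1 hq₀] at hsep
  have hsimple := hsep.aeval_derivative_ne_zero
    ((coe_aeval_eq_eval (R := ℝ) _ ▸ hroot q₀ :) : aeval (‖q₀ u - q₀ v‖ ^ 2) _ = 0)
  exact ⟨q₀, exists_eventually_norm_sub_eq_of_derivative_ne_zero
    (coe_aeval_eq_eval (R := ℝ) _ ▸ hsimple) hroot fun q hq => hmin q (hq₀.trans hq)⟩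

end Frameworks

end GraphRigidity

open GraphRigidity Topology in
theorem mainTheorem8_general {V : Type*} [Countable V] (d : ℕ) (G : SimpleGraph V) (u v : V)
    (V₀ : Set V) [Finite V₀] (hu : u ∈ V₀) (hv : v ∈ V₀)
    (hlinked : ∃ p : Realization V₀ d,
      IsGeneric p ∧ LocallyLinkedIn (G.induce V₀) p ⟨u, hu⟩ ⟨v, hv⟩)
    (hP : ∃ P : G.Walk u v, IsInternallyDisjointPath P V₀) :
    WeaklyGloballyLinked d G u v := by
  obtain ⟨p₀, hgeneric, hlinked⟩ := hlinked
  obtain ⟨P, hP⟩ := hP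
  obtain ⟨q₀, a, hq₀, hdetermined⟩ := hlinked.exists_eventually_norm_sub_eq hgeneric
  obtain ⟨q₁, rfl, hlength⟩ := hP.exists_extension_walkLength_eq hu hv q₀
  have hrestrict : Continuous (V₀.domRestrict : Realization V d → Realization V₀ d) :=
    continuous_pi fun x => continuous_apply x.1
  have hshort : ∀ᶠ p in 𝓝 q₁, walkLength P p < a :=
    ((continuous_walkLength P).tendsto q₁).eventually_lt_const (hlength.trans_lt hq₀)
  obtain ⟨p, hp, hdetermined, hshort⟩ := dense_setOf_isGeneric.inter_nhds_nonempty
    (((hrestrict.tendsto q₁).eventually hdetermined).and hshort)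
  refine ⟨p, hp, fun q hq => hdetermined (V₀.domRestrict q) (fun x y hxy => hq x y hxy) ?_⟩
  calc ‖q u - q v‖ ≤ walkLength P q := norm_sub_le_walkLength P q
    _ = walkLength P p := (hq.walkLength_eq P).symm
    _ < a := hshort

theorem mainTheorem8 {V : Type*} [Finite V] (d : ℕ) (G : SimpleGraph V) (u v : V)
    (V₀ : Set V) (hV₀ : GraphRigidity.IsPairRigid d G u v V₀)
    (hP : ∃ P : G.Walk u v, GraphRigidity.IsInternallyDisjointPath P V₀) :
    GraphRigidity.WeaklyGloballyLinked d G u v := by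
  obtain ⟨hu, hv, hrigid⟩ := hV₀
  obtain ⟨p, hp⟩ := GraphRigidity.dense_setOf_isGeneric (V := V₀) (d := d) |>.nonempty
  exact mainTheorem8_general d G u v V₀ hu hv ⟨p, hp, (hrigid p hp).locallyLinkedIn _ _⟩ hP
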